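/- Let $\mathcal M\neq 0$ be a finite-dimensional von Neumann algebra with a faithful positive trace $\tau$, and let $\mathcal A,\mathcal B\subseteq\mathcal M$ and $\mathcal R\subseteq\mathcal A\cap\mathcal B$ be unital $*$-subalgebras, each equipped with the trace induced by restricting $\tau$. For a subalgebra $\mathcal N\in\{\mathcal R,\mathcal A,\mathcal B\}$ let $E_{\mathcal N}:\mathcal M\to\mathcal N$ be the trace-preserving conditional expectation, i.e. the adjoint of the inclusion, determined by $\tau(x\,E_{\mathcal N}(\rho))=\tau(x\rho)$ for all $x\in\mathcal N$, $\rho\in\mathcal M$. For $\rho\ge 0$ let $H(\rho)=-\tau(\rho\log\rho)$ (natural logarithm, $0\log 0=0$). Put $$c=\sup\{\tau(ab) : a\in\mathcal A,\ b\in\mathcal B,\ a\ge 0,\ b\ge 0,\ E_{\mathcal R}(a)=1,\ \tau(b)=1\}.$$ Then this supremum is finite (and over a nonempty set), and for every density operator $\rho\in\mathcal M$ (i.e. $\rho\ge 0$, $\tau(\rho)=1$), $$H(E_{\mathcal A}(\rho))+H(E_{\mathcal B}(\rho))\ \ge\ H(\rho)+H(E_{\mathcal R}(\rho))+\log\frac1c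 .$$ Moreover, $c=1$ if and only if $E_{\mathcal A}E_{\mathcal B}=E_{\mathcal B}E_{\mathcal A}=E_{\mathcal R}$ (the commuting square condition). -/

import Mathlib

open scoped ComplexOrder

/-- A faithful (positive, tracial) trace on a finite-dimensional von Neumann algebra. -/
structure FaithfulTrace (M : Type*) [CStarAlgebra M] [PartialOrder M] [StarOrderedRing M] where
  /-- the underlying positive linear functional -/
  toFun : M →ₚ[ℂ] ℂ
  tracial : ∀ x y : M, toFun (x * y) = toFun (y * x)
  faithful : ∀ x : M, 0 ≤ x → toFun x = 0 → x = 0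

namespace FaithfulTrace

variable {M : Type*} [CStarAlgebra M] [PartialOrder M] [StarOrderedRing M]

noncomputable instance : CoeFun (FaithfulTrace M) (fun _ => M → ℂ) := ⟨fun τ x => τ.toFun x⟩

/-- For `y` in a subalgebra `N`, the functional `x ↦ τ (x * y)` on `N`, linear in `y`.
It only involves the induced trace `τ|_N`. -/
noncomputable def pairing (τ : FaithfulTrace M) (N : StarSubalgebra ℂ M) : N →ₗ[ℂ] Module.Dual ℂ N :=
  LinearMap.mk₂ ℂ (fun y x : N => τ ((x : M) * (y : M)))
    (by intro y z x; simp [mul_add]) (by intro c y x; simp)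
    (by intro y x z; simp [add_mul]) (by intro c y x; simp)

theorem pairing_injective (τ : FaithfulTrace M) (N : StarSubalgebra ℂ M) :
    Function.Injective (τ.pairing N) := by
  rw [injective_iff_map_eq_zero]
  intro y hy
  have h : τ (star (y : M) * (y : M)) = 0 := by
    have := LinearMap.congr_fun hy (star y)
    simpa [pairing] using this
  have h2 := τ.faithful _ (star_mul_self_nonneg (y : M)) h
  exact Subtype.ext (by simpa using CStarRing.star_mul_self_eq_zero_iff (y : M) |>.1 h2)

variable [FiniteDimensional ℂ M]

/-- The map `ρ ↦ E_N ρ`, `M → N`, adjoint to the inclusion `N ⊆ M` with respect to the traces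
`τ` on `M` and `τ|_N` on `N`: for every `x ∈ N`, `τ (x * E_N ρ) = τ (x * ρ)`. -/
noncomputable def adjointInclusion (τ : FaithfulTrace M) (N : StarSubalgebra ℂ M) : M →ₗ[ℂ] N :=
  haveI : FiniteDimensional ℂ N :=
    inferInstanceAs (FiniteDimensional ℂ (Subalgebra.toSubmodule N.toSubalgebra))
  (LinearEquiv.ofInjectiveOfFinrankEq (τ.pairing N) (τ.pairing_injective N)
      (Subspace.dual_finrank_eq).symm).symm.toLinearMap ∘ₗ
    LinearMap.mk₂ ℂ (fun (ρ : M) (x : N) => τ ((x : M) * ρ))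
      (by intro y z x; simp [mul_add]) (by intro c y x; simp)
      (by intro y x z; simp [add_mul]) (by intro c y x; simp)

/-- The trace-preserving conditional expectation `E_N`, regarded as a map `M → M` with values
in `N`. -/
noncomputable def condExp (τ : FaithfulTrace M) (N : StarSubalgebra ℂ M) : M →ₗ[ℂ] M :=
  N.subtype.toLinearMap ∘ₗ τ.adjointInclusion N

theorem condExp_mem (τ : FaithfulTrace M) (N : StarSubalgebra ℂ M) (ρ : M) :
    τ.condExp N ρ ∈ N := (τ.adjointInclusion N ρ).2

/-- The defining property of the conditional expectation. -/
theorem trace_mul_condExp (τ : FaithfulTrace M) (N : StarSubalgebra ℂ M) (ρ x : M) (hx : x ∈ N) :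
    τ (x * τ.condExp N ρ) = τ (x * ρ) := by
  have : FiniteDimensional ℂ N :=
    inferInstanceAs (FiniteDimensional ℂ (Subalgebra.toSubmodule N.toSubalgebra))
  have h : τ.pairing N (τ.adjointInclusion N ρ) ⟨x, hx⟩ = τ (x * ρ) := by
    have := (LinearEquiv.ofInjectiveOfFinrankEq (τ.pairing N) (τ.pairing_injective N)
      (Subspace.dual_finrank_eq).symm).apply_symm_apply
      (LinearMap.mk₂ ℂ (fun (ρ : M) (x : N) => τ ((x : M) * ρ))
        (by intro y z x; simp [mul_add]) (by intro c y x; simp)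
        (by intro y x z; simp [add_mul]) (by intro c y x; simp) ρ)
    exact LinearMap.congr_fun this ⟨x, hx⟩
  exact h

/-- Density operators: `ρ ≥ 0` and `τ ρ = 1`. -/
def IsDensity (τ : FaithfulTrace M) (ρ : M) : Prop := 0 ≤ ρ ∧ τ ρ = 1

/-- The von Neumann entropy `H(ρ) = -τ (ρ log ρ)`, where `-ρ log ρ` is obtained by functional
calculus from `t ↦ -t log t` (with `0 log 0 = 0`). For an element of a subalgebra it is the
entropy with respect to the induced trace. -/
noncomputable def entropy (τ : FaithfulTrace M) (ρ : M) : ℝ := (τ (cfc Real.negMulLog ρ)).re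

/-- The values `τ (a b)` (which are real) with `a ∈ A`, `b ∈ B` positive, `E_R a = 1`,
`τ b = 1`. -/
def overlapSet (τ : FaithfulTrace M) (R A B : StarSubalgebra ℂ M) : Set ℝ :=
  {t | ∃ a ∈ A, ∃ b ∈ B, 0 ≤ a ∧ 0 ≤ b ∧ τ.condExp R a = 1 ∧ τ b = 1 ∧ τ (a * b) = (t : ℂ)}

/-- The constant `c`, the supremum of the overlaps. -/
noncomputable def overlap (τ : FaithfulTrace M) (R A B : StarSubalgebra ℂ M) : ℝ :=
  sSup (τ.overlapSet R A B)

end FaithfulTrace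

/-! Write D(ρ‖σ) = τ(ρ log ρ) - τ(ρ log σ). For invertible ρ, H(E_A ρ) - H(ρ) = D(ρ‖E_A ρ) ≥ D(E_B
ρ‖E_B E_A ρ) ≥ D(E_B ρ‖E_R ρ) - τ(ρ) log c, and the last relative entropy is H(E_R ρ) - H(E_B ρ).
The first inequality is data processing (`condExp_relEntropy_le`). The second follows from E_B E_A ρ
≤ c E_R ρ (`condExp_condExp_le`) and operator monotonicity of log. General ρ is reached through ρ +
ε1, ε → 0.

Data processing comes from a variational formula. If σx + s xρ = ρ, then τ(ρx) is the maximum of a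
concave quadratic form; restricting the form to N amounts to replacing ρ, σ by their expectations,
so the maximum can only drop. Integrating over s from 0 to ∞ turns these maxima into relative
entropies.

If c = 1, the positive element E_R ρ - E_B E_A ρ has trace zero, hence vanishes. -/

theorem StarSubalgebra.cfc_mem_of_finiteDimensional {M : Type*} [CStarAlgebra M]
    [FiniteDimensional ℂ M] (N : StarSubalgebra ℂ M) {a : M} (ha : a ∈ N) (f : ℝ → ℝ) :
    cfc f a ∈ N := by
  have : IsClosed (N : Set M) :=
    Submodule.closed_of_finiteDimensional (Subalgebra.toSubmodule N.toSubalgebra)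
  exact cfc_mem (𝕜' := ℂ) f ha

/-! ### Positivity of the trace and of conditional expectations. -/

namespace FaithfulTrace

variable {M : Type*} [CStarAlgebra M] [PartialOrder M] [StarOrderedRing M]

theorem trace_nonneg (τ : FaithfulTrace M) {x : M} (hx : 0 ≤ x) : 0 ≤ τ.toFun x := by
  have := OrderHomClass.mono τ.toFun hx
  simpa using this

theorem trace_real_smul (τ : FaithfulTrace M) (c : ℝ) (x : M) :
    τ.toFun (c • x) = c * τ.toFun x := by
  rw [← Complex.coe_smul, map_smul, smul_eq_mul]

theorem trace_star (τ : FaithfulTrace M) (x : M) : τ.toFun (star x) = star (τ.toFun x) := by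
  exact map_star τ.toFun x

theorem trace_re_nonneg (τ : FaithfulTrace M) {x : M} (hx : 0 ≤ x) : 0 ≤ (τ.toFun x).re :=
  (Complex.nonneg_iff.1 (τ.trace_nonneg hx)).1

theorem eq_zero_of_re_eq_zero (τ : FaithfulTrace M) {x : M} (hx : 0 ≤ x) (h : (τ.toFun x).re = 0) :
    x = 0 :=
  τ.faithful x hx (Complex.ext h (by simpa using (Complex.nonneg_iff.1 (τ.trace_nonneg hx)).2.symm))

/-- The trace of a product of two positive elements is nonnegative. -/
theorem trace_mul_nonneg (τ : FaithfulTrace M) {x y : M} (hx : 0 ≤ x) (hy : 0 ≤ y) :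
    0 ≤ τ.toFun (x * y) := by
  obtain ⟨z, rfl⟩ := CStarAlgebra.nonneg_iff_eq_star_mul_self.1 hx
  rw [mul_assoc, τ.tracial, mul_assoc]
  have := star_left_conjugate_nonneg hy (star z)
  rw [star_star, mul_assoc] at this
  exact τ.trace_nonneg this

theorem trace_mul_re_nonneg (τ : FaithfulTrace M) {x y : M} (hx : 0 ≤ x) (hy : 0 ≤ y) :
    0 ≤ (τ.toFun (x * y)).re :=
  (Complex.nonneg_iff.1 (τ.trace_mul_nonneg hx hy)).1

theorem trace_mul_re_mono (τ : FaithfulTrace M) {x y z : M} (hx : 0 ≤ x) (h : y ≤ z) :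
    (τ.toFun (x * y)).re ≤ (τ.toFun (x * z)).re := by
  have := τ.trace_mul_re_nonneg hx (sub_nonneg.2 h)
  rw [mul_sub, map_sub] at this
  simpa using this

theorem eq_of_trace_mul_eq (τ : FaithfulTrace M) {N : StarSubalgebra ℂ M} {y z : M} (hy : y ∈ N)
    (hz : z ∈ N) (h : ∀ x ∈ N, τ.toFun (x * y) = τ.toFun (x * z)) : y = z := by
  have h1 : τ.toFun (star (y - z) * (y - z)) = 0 := by
    rw [mul_sub, map_sub, h _ (star_mem (sub_mem hy hz)), sub_self]
  have h2 := τ.faithful _ (star_mul_self_nonneg _) h1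
  exact sub_eq_zero.1 ((CStarRing.star_mul_self_eq_zero_iff _).1 h2)

variable [FiniteDimensional ℂ M]

/-- Test against the negative part b of y, which lies in N: by = -b², so τ(b²) ≤ 0 and faithfulness
gives b = 0. -/
theorem nonneg_of_trace_mul_re_nonneg (τ : FaithfulTrace M) {N : StarSubalgebra ℂ M} {y : M}
    (hy : y ∈ N) (hys : IsSelfAdjoint y)
    (h : ∀ b ∈ N, 0 ≤ b → 0 ≤ (τ.toFun (b * y)).re) : 0 ≤ y := by
  set b := cfc (fun t : ℝ => max (-t) 0) y with hb
  have hbN : b ∈ N := N.cfc_mem_of_finiteDimensional hy _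
  have hb0 : 0 ≤ b := cfc_nonneg (fun t _ => le_max_right _ _)
  have hby : b * y = -(b * b) := by
    conv_lhs => rw [hb, ← cfc_id' ℝ y]
    rw [hb, cfc_id' ℝ y, ← cfc_mul _ _ y, ← cfc_neg]
    nth_rewrite 2 [← cfc_id' ℝ y]
    rw [← cfc_mul _ _ y]
    congr 1
    funext t
    rcases le_total (-t) 0 with h | h
    · simp [max_eq_right h]
    · simp [max_eq_left h]
  have hbs : IsSelfAdjoint b := .of_nonneg hb0
  have hbb : 0 ≤ b * b := by simpa [hbs.star_eq] using star_mul_self_nonneg b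
  have h1 := h b hbN hb0
  have h2 := τ.trace_re_nonneg hbb
  have h3 : b * b = 0 := by
    refine τ.eq_zero_of_re_eq_zero hbb (le_antisymm ?_ h2)
    rw [hby, map_neg] at h1
    simpa using h1
  have h4 : b = 0 := by
    rw [← CStarRing.star_mul_self_eq_zero_iff, hbs.star_eq, h3]
  have h5 : y = cfc (fun t : ℝ => max t 0) y - b := by
    nth_rewrite 1 [← cfc_id' ℝ y]
    rw [hb, ← cfc_sub _ _ y]
    congr 1
    funext t
    rcases le_total t 0 with h | h
    · simp [h]
    · simp [h]
  rw [h5, h4, sub_zero]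
  exact cfc_nonneg (fun t _ => le_max_right _ _)

section condExp

variable (τ : FaithfulTrace M) (N : StarSubalgebra ℂ M)

theorem toFun_mul_condExp (ρ : M) {x : M} (hx : x ∈ N) :
    τ.toFun (x * τ.condExp N ρ) = τ.toFun (x * ρ) :=
  τ.trace_mul_condExp N ρ x hx

theorem condExp_eq_of {x y : M} (hy : y ∈ N) (h : ∀ z ∈ N, τ.toFun (z * y) = τ.toFun (z * x)) :
    τ.condExp N x = y :=
  τ.eq_of_trace_mul_eq (τ.condExp_mem N x) hy fun z hz => by
    rw [τ.toFun_mul_condExp N x hz, h z hz]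

theorem condExp_of_mem {x : M} (hx : x ∈ N) : τ.condExp N x = x :=
  τ.condExp_eq_of N hx fun _ _ => rfl

theorem condExp_one : τ.condExp N 1 = 1 := τ.condExp_of_mem N (one_mem N)

theorem trace_condExp (x : M) : τ.toFun (τ.condExp N x) = τ.toFun x := by
  simpa using τ.toFun_mul_condExp N x (one_mem N)

theorem trace_condExp_mul (x y : M) :
    τ.toFun (τ.condExp N x * y) = τ.toFun (x * τ.condExp N y) := by
  rw [← τ.toFun_mul_condExp N y (τ.condExp_mem N x), τ.tracial,
    τ.toFun_mul_condExp N x (τ.condExp_mem N y), τ.tracial]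

theorem condExp_mul_mul {x y : M} (hx : x ∈ N) (hy : y ∈ N) (a : M) :
    τ.condExp N (x * a * y) = x * τ.condExp N a * y := by
  refine τ.condExp_eq_of N (mul_mem (mul_mem hx (τ.condExp_mem N a)) hy) fun z hz => ?_
  rw [← mul_assoc, τ.tracial, ← mul_assoc z (x * a) y,
    τ.tracial (z * (x * a)) y]
  simp only [← mul_assoc]
  exact τ.toFun_mul_condExp N a (mul_mem (mul_mem hy hz) hx)

theorem condExp_star (x : M) : τ.condExp N (star x) = star (τ.condExp N x) := by
  refine τ.condExp_eq_of N (star_mem (τ.condExp_mem N x)) fun z hz => ?_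
  have := τ.toFun_mul_condExp N x (star_mem hz)
  rw [← star_star z, ← star_mul, ← star_mul, trace_star, trace_star, τ.tracial, this, τ.tracial]

theorem condExp_nonneg {x : M} (hx : 0 ≤ x) : 0 ≤ τ.condExp N x := by
  refine τ.nonneg_of_trace_mul_re_nonneg (τ.condExp_mem N x) ?_ fun b hb hb0 => ?_
  · rw [isSelfAdjoint_iff, ← condExp_star, (IsSelfAdjoint.of_nonneg hx).star_eq]
  · rw [τ.toFun_mul_condExp N x hb]
    exact τ.trace_mul_re_nonneg hb0 hx

theorem condExp_mono {x y : M} (h : x ≤ y) : τ.condExp N x ≤ τ.condExp N y := by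
  have := τ.condExp_nonneg N (sub_nonneg.2 h)
  rwa [map_sub, sub_nonneg] at this

theorem condExp_isStrictlyPositive [Nontrivial M] {x : M} (hx : IsStrictlyPositive x) :
    IsStrictlyPositive (τ.condExp N x) := by
  obtain ⟨r, hr, h⟩ := (CFC.exists_pos_algebraMap_le_iff hx.isSelfAdjoint).2
    fun _ => hx.spectrum_pos
  refine (isStrictlyPositive_algebraMap hr).of_le (b := τ.condExp N x) ?_
  have := τ.condExp_mono N h
  rwa [τ.condExp_of_mem N] at this
  rw [Algebra.algebraMap_eq_smul_one, ← Complex.coe_smul]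
  exact N.smul_mem (one_mem N) _

end condExp

end FaithfulTrace

/-! ### Finite spectral decompositions and the Sylvester equation. -/

section Spectral

variable {M : Type*} [CStarAlgebra M] [FiniteDimensional ℂ M]

/-- Spectral values are roots of a monic real polynomial annihilating a. Finiteness makes every
function continuous on the spectrum, so `cfc` applies even to indicators of points. -/
theorem spectrum_real_finite_of_finiteDimensional (a : M) : (spectrum ℝ a).Finite := by
  have : FiniteDimensional ℝ M := FiniteDimensional.complexToReal M
  obtain ⟨p, hp, hpa⟩ := Algebra.IsIntegral.isIntegral (R := ℝ) a
  refine (p.roots.toFinset.finite_toSet).subset fun x hx => ?_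
  have h1 := spectrum.subset_polynomial_aeval a p ⟨x, hx, rfl⟩
  have h2 : Polynomial.aeval a p = 0 := hpa
  rcases subsingleton_or_nontrivial M with hM | hM
  · exact absurd hx (by simp [spectrum.of_subsingleton])
  rw [h2, spectrum.zero_eq, Set.mem_singleton_iff] at h1
  simp [hp.ne_zero, h1]

/-- The real spectrum as a finset. -/
noncomputable def specFinset (a : M) : Finset ℝ :=
  (spectrum_real_finite_of_finiteDimensional a).toFinset

theorem mem_specFinset {a : M} {t : ℝ} : t ∈ specFinset a ↔ t ∈ spectrum ℝ a := by
  simp [specFinset]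

theorem continuousOn_spectrum_of_finiteDimensional (a : M) (f : ℝ → ℝ) :
    ContinuousOn f (spectrum ℝ a) :=
  (spectrum_real_finite_of_finiteDimensional a).continuousOn f

/-- The spectral projection of `a` for the value `t`. -/
noncomputable def specProj (a : M) (t : ℝ) : M := cfc (Pi.single t (1 : ℝ) : ℝ → ℝ) a

theorem cfc_eq_sum_specProj (a : M) (f : ℝ → ℝ) :
    cfc f a = ∑ t ∈ specFinset a, f t • specProj a t := by
  have h : cfc f a = cfc (∑ t ∈ specFinset a, f t • (Pi.single t (1 : ℝ) : ℝ → ℝ)) a := by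
    refine cfc_congr fun x hx => ?_
    have hx' := mem_specFinset.2 hx
    simp [Finset.sum_apply, Pi.single_apply, hx']
  rw [h, cfc_sum _ _ _ (fun _ _ => continuousOn_spectrum_of_finiteDimensional a _)]
  refine Finset.sum_congr rfl fun t _ => ?_
  exact cfc_smul (f t) (Pi.single t (1 : ℝ) : ℝ → ℝ) a
    (continuousOn_spectrum_of_finiteDimensional a _)

theorem sum_specProj {a : M} (ha : IsSelfAdjoint a) : ∑ t ∈ specFinset a, specProj a t = 1 := by
  have := cfc_eq_sum_specProj a (fun _ => 1)
  rw [cfc_const_one ℝ a] at this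
  simpa using this.symm

theorem sum_smul_specProj {a : M} (ha : IsSelfAdjoint a) :
    ∑ t ∈ specFinset a, t • specProj a t = a := by
  have := cfc_eq_sum_specProj a (fun t => t)
  rw [cfc_id' ℝ a] at this
  exact this.symm

theorem mul_specProj {a : M} (ha : IsSelfAdjoint a) (t : ℝ) :
    a * specProj a t = t • specProj a t := by
  unfold specProj
  nth_rewrite 1 [← cfc_id' ℝ a]
  rw [← cfc_mul _ _ a (continuousOn_spectrum_of_finiteDimensional a _)
    (continuousOn_spectrum_of_finiteDimensional a _),
    ← cfc_smul _ _ _ (continuousOn_spectrum_of_finiteDimensional a _)]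
  congr 1
  funext x
  by_cases h : x = t <;> simp [h]

theorem specProj_mul {a : M} (ha : IsSelfAdjoint a) (t : ℝ) :
    specProj a t * a = t • specProj a t := by
  rw [← mul_specProj ha]
  have := (cfc_commute_cfc (Pi.single t (1 : ℝ) : ℝ → ℝ) (fun x => x) a).eq
  rw [cfc_id' ℝ a] at this
  exact this

theorem specProj_mem {N : StarSubalgebra ℂ M} {a : M} (ha : a ∈ N) (t : ℝ) : specProj a t ∈ N :=
  N.cfc_mem_of_finiteDimensional ha _

/-- The solution `x` of the Sylvester equation `σ x + s x ρ = ρ`. -/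
noncomputable def sylvester (ρ σ : M) (s : ℝ) : M :=
  ∑ i ∈ specFinset ρ, ∑ j ∈ specFinset σ, (i / (j + s * i)) • (specProj σ j * specProj ρ i)

theorem sylvester_mem {N : StarSubalgebra ℂ M} {ρ σ : M} (hρ : ρ ∈ N) (hσ : σ ∈ N) (s : ℝ) :
    sylvester ρ σ s ∈ N := by
  refine sum_mem fun i _ => sum_mem fun j _ => ?_
  rw [← Complex.coe_smul]
  exact N.smul_mem (mul_mem (specProj_mem hσ j) (specProj_mem hρ i)) _

variable [PartialOrder M] [StarOrderedRing M]

theorem specFinset_pos {a : M} (ha : IsStrictlyPositive a) {t : ℝ} (ht : t ∈ specFinset a) :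
    0 < t :=
  ha.spectrum_pos (mem_specFinset.1 ht)

theorem sylvester_eq {ρ σ : M} (hρ : IsStrictlyPositive ρ) (hσ : IsStrictlyPositive σ) {s : ℝ}
    (hs : 0 ≤ s) : σ * sylvester ρ σ s + s • (sylvester ρ σ s * ρ) = ρ := by
  -- On the (j, i) block the operator x ↦ σx + s xρ is multiplication by j + s i, which cancels the
  -- denominator.
  have h : ∀ i ∈ specFinset ρ, ∀ j ∈ specFinset σ,
      σ * ((i / (j + s * i)) • (specProj σ j * specProj ρ i)) +
        s • (((i / (j + s * i)) • (specProj σ j * specProj ρ i)) * ρ) =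
      specProj σ j * (i • specProj ρ i) := by
    intro i hi j hj
    have hi := specFinset_pos hρ hi
    have hj := specFinset_pos hσ hj
    have h0 : j + s * i ≠ 0 := by positivity
    rw [mul_smul_comm, ← mul_assoc, mul_specProj hσ.isSelfAdjoint, smul_mul_assoc, smul_mul_assoc,
      mul_assoc, specProj_mul hρ.isSelfAdjoint, mul_smul_comm, smul_smul,
      smul_smul, smul_smul, ← add_smul]
    congr 1
    field_simp
  unfold sylvester
  simp only [Finset.mul_sum, Finset.sum_mul, Finset.smul_sum, ← Finset.sum_add_distrib]
  rw [Finset.sum_congr rfl fun i hi => Finset.sum_congr rfl fun j hj => h i hi j hj]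
  simp only [← Finset.sum_mul, sum_specProj hσ.isSelfAdjoint, one_mul,
    sum_smul_specProj hρ.isSelfAdjoint]

end Spectral

/-! ### The variational formula and its monotonicity. -/

namespace FaithfulTrace

variable {M : Type*} [CStarAlgebra M] [PartialOrder M] [StarOrderedRing M]

/-- The concave quadratic functional whose maximum is `τ (ρ x)` for the solution `x` of
the Sylvester equation `σ x + s x ρ = ρ`. -/
noncomputable def sylvesterForm (τ : FaithfulTrace M) (ρ σ : M) (s : ℝ) (x : M) : ℝ :=
  2 * (τ.toFun (ρ * x)).re - (τ.toFun (star x * σ * x)).re - s * (τ.toFun (x * ρ * star x)).re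

theorem sylvesterForm_of_eq (τ : FaithfulTrace M) {ρ σ x : M} {s : ℝ}
    (hρ : IsSelfAdjoint ρ) (h : σ * x + s • (x * ρ) = ρ) :
    τ.sylvesterForm ρ σ s x = (τ.toFun (ρ * x)).re := by
  have h1 : τ.toFun (star x * ρ) = star (τ.toFun (ρ * x)) := by
    rw [← trace_star, star_mul, hρ.star_eq]
  have h2 : τ.toFun (star x * σ * x) + s * τ.toFun (x * ρ * star x) = τ.toFun (star x * ρ) := by
    rw [τ.tracial (x * ρ), ← trace_real_smul, ← map_add, ← mul_smul_comm, mul_assoc, ← mul_add, h]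
  have h3 := congrArg Complex.re (h2.trans h1)
  simp at h3
  unfold sylvesterForm
  linarith

/-- Completing the square: the gap is τ((y-x)*σ(y-x)) + s τ((y-x)ρ(y-x)*) ≥ 0. The equation for x
evaluates the cross terms. -/
theorem sylvesterForm_le_of_eq (τ : FaithfulTrace M) {ρ σ x : M} {s : ℝ}
    (hρ : 0 ≤ ρ) (hσ : 0 ≤ σ) (hs : 0 ≤ s) (h : σ * x + s • (x * ρ) = ρ) (y : M) :
    τ.sylvesterForm ρ σ s y ≤ (τ.toFun (ρ * x)).re := by
  have hρs := (IsSelfAdjoint.of_nonneg hρ).star_eq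
  have hσs := (IsSelfAdjoint.of_nonneg hσ).star_eq
  have h1 := τ.trace_re_nonneg (star_left_conjugate_nonneg hσ (y - x))
  have h2 := mul_nonneg hs (τ.trace_re_nonneg (star_right_conjugate_nonneg hρ (y - x)))
  have hx := τ.sylvesterForm_of_eq (.of_nonneg hρ) h
  have h3 : (τ.toFun (star y * σ * x)).re + s * (τ.toFun (x * ρ * star y)).re =
      (τ.toFun (ρ * y)).re := by
    have : τ.toFun (star y * σ * x) + s * τ.toFun (x * ρ * star y) = star (τ.toFun (ρ * y)) := by
      rw [τ.tracial (x * ρ), ← trace_real_smul, ← map_add, ← mul_smul_comm, mul_assoc, ← mul_add,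
        h, ← trace_star, star_mul, hρs]
    simpa using congrArg Complex.re this
  have h4 : (τ.toFun (star x * σ * y)).re = (τ.toFun (star y * σ * x)).re := by
    have : star x * σ * y = star (star y * σ * x) := by simp [mul_assoc, hσs]
    rw [this, trace_star]; simp
  have h5 : (τ.toFun (y * ρ * star x)).re = (τ.toFun (x * ρ * star y)).re := by
    have : y * ρ * star x = star (x * ρ * star y) := by simp [mul_assoc, hρs]
    rw [this, trace_star]; simp
  simp only [star_sub, sub_mul, mul_sub, map_sub, Complex.sub_re] at h1 h2
  unfold sylvesterForm at hx ⊢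
  rw [h5] at h2
  rw [h4] at h1
  linarith

variable [FiniteDimensional ℂ M]

/-- Monotonicity of `τ (ρ x)`, `x` the solution of the Sylvester equation, under conditional
expectations. -/
theorem trace_mul_sylvester_condExp_le [Nontrivial M] (τ : FaithfulTrace M)
    (N : StarSubalgebra ℂ M) {ρ σ : M} (hρ : IsStrictlyPositive ρ) (hσ : IsStrictlyPositive σ)
    {s : ℝ} (hs : 0 ≤ s) :
    (τ.toFun (τ.condExp N ρ * sylvester (τ.condExp N ρ) (τ.condExp N σ) s)).re ≤
      (τ.toFun (ρ * sylvester ρ σ s)).re := by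
  have hρ' := τ.condExp_isStrictlyPositive N hρ
  have hσ' := τ.condExp_isStrictlyPositive N hσ
  set x := sylvester (τ.condExp N ρ) (τ.condExp N σ) s with hx
  have hxN : x ∈ N := sylvester_mem (τ.condExp_mem N ρ) (τ.condExp_mem N σ) s
  rw [← τ.sylvesterForm_of_eq hρ'.isSelfAdjoint (sylvester_eq hρ' hσ' hs)]
  -- Since x lies in N, the forms of (ρ, σ) and of their expectations agree at x, but for (ρ, σ) it
  -- is only one competitor for the maximum.
  refine le_trans (le_of_eq ?_)
    (τ.sylvesterForm_le_of_eq hρ.nonneg hσ.nonneg hs (sylvester_eq hρ hσ hs) x)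
  unfold sylvesterForm
  have e1 : τ.toFun (τ.condExp N ρ * x) = τ.toFun (ρ * x) := by
    rw [τ.tracial, τ.toFun_mul_condExp N ρ hxN, τ.tracial]
  have e2 : τ.toFun (star x * τ.condExp N σ * x) = τ.toFun (star x * σ * x) := by
    rw [τ.tracial, ← mul_assoc, τ.toFun_mul_condExp N σ (mul_mem hxN (star_mem hxN)),
      mul_assoc, τ.tracial]
  have e3 : τ.toFun (x * τ.condExp N ρ * star x) = τ.toFun (x * ρ * star x) := by
    rw [τ.tracial, ← mul_assoc, τ.toFun_mul_condExp N ρ (mul_mem (star_mem hxN) hxN),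
      mul_assoc, τ.tracial]
  rw [← hx, e1, e2, e3]

end FaithfulTrace

/-! ### Integration in s and data processing for relative entropy. -/

namespace FaithfulTrace

variable {M : Type*} [CStarAlgebra M] [PartialOrder M] [StarOrderedRing M]
  [FiniteDimensional ℂ M]

/-- The joint spectral weights of two self-adjoint elements. -/
noncomputable def specWeight (τ : FaithfulTrace M) (ρ σ : M) (i j : ℝ) : ℝ :=
  (τ.toFun (specProj ρ i * specProj σ j)).re

theorem trace_cfc_mul_cfc (τ : FaithfulTrace M) (ρ σ : M) (f g : ℝ → ℝ) :
    (τ.toFun (cfc f ρ * cfc g σ)).re =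
      ∑ i ∈ specFinset ρ, ∑ j ∈ specFinset σ, f i * g j * τ.specWeight ρ σ i j := by
  rw [cfc_eq_sum_specProj ρ f, cfc_eq_sum_specProj σ g, Finset.sum_mul_sum, map_sum,
    Complex.re_sum]
  refine Finset.sum_congr rfl fun i _ => ?_
  rw [map_sum, Complex.re_sum]
  refine Finset.sum_congr rfl fun j _ => ?_
  rw [smul_mul_smul_comm, trace_real_smul, Complex.re_ofReal_mul]
  rfl

theorem trace_cfc_eq_sum (τ : FaithfulTrace M) {ρ σ : M} (hσ : IsSelfAdjoint σ) (f : ℝ → ℝ) :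
    (τ.toFun (cfc f ρ)).re =
      ∑ i ∈ specFinset ρ, ∑ j ∈ specFinset σ, f i * τ.specWeight ρ σ i j := by
  have := τ.trace_cfc_mul_cfc ρ σ f (fun _ => 1)
  rw [cfc_const_one ℝ σ] at this
  simpa using this

theorem trace_mul_sylvester (τ : FaithfulTrace M) {ρ : M} (hρ : IsSelfAdjoint ρ) (σ : M) (s : ℝ) :
    (τ.toFun (ρ * sylvester ρ σ s)).re =
      ∑ i ∈ specFinset ρ, ∑ j ∈ specFinset σ, i * (i / (j + s * i)) * τ.specWeight ρ σ i j := by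
  unfold sylvester
  rw [Finset.mul_sum, map_sum, Complex.re_sum]
  refine Finset.sum_congr rfl fun i _ => ?_
  rw [Finset.mul_sum, map_sum, Complex.re_sum]
  refine Finset.sum_congr rfl fun j _ => ?_
  rw [mul_smul_comm, τ.trace_real_smul, τ.tracial, mul_assoc, specProj_mul hρ, mul_smul_comm,
    trace_real_smul, τ.tracial, Complex.re_ofReal_mul, Complex.re_ofReal_mul]
  unfold specWeight
  ring

/-- A primitive in `s` of `τ (ρ x)`, where `σ x + s x ρ = ρ`. -/
noncomputable def logForm (τ : FaithfulTrace M) (ρ σ : M) (s : ℝ) : ℝ :=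
  ∑ i ∈ specFinset ρ, ∑ j ∈ specFinset σ, i * Real.log (j + s * i) * τ.specWeight ρ σ i j

theorem logForm_zero (τ : FaithfulTrace M) {ρ : M} (hρ : IsSelfAdjoint ρ) (σ : M) :
    τ.logForm ρ σ 0 = (τ.toFun (ρ * CFC.log σ)).re := by
  have := τ.trace_cfc_mul_cfc ρ σ (fun t => t) Real.log
  rw [cfc_id' ℝ ρ] at this
  simp only [CFC.log, this, logForm, zero_mul, add_zero]

theorem hasDerivAt_logForm (τ : FaithfulTrace M) {ρ σ : M} (hρ : IsStrictlyPositive ρ)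
    (hσ : IsStrictlyPositive σ) {s : ℝ} (hs : 0 ≤ s) :
    HasDerivAt (τ.logForm ρ σ) (τ.toFun (ρ * sylvester ρ σ s)).re s := by
  rw [τ.trace_mul_sylvester hρ.isSelfAdjoint]
  unfold logForm
  refine HasDerivAt.fun_sum fun i hi => HasDerivAt.fun_sum fun j hj => ?_
  have hi := specFinset_pos hρ hi
  have hj := specFinset_pos hσ hj
  have h0 : j + s * i ≠ 0 := by positivity
  have h1 : HasDerivAt (fun s : ℝ => j + s * i) i s := by
    simpa using ((hasDerivAt_id s).mul_const i).const_add j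
  exact ((h1.log h0).const_mul i).mul_const _

open Filter Topology in
-- Since log(j + T i) - log T = log(j/T + i) → log i for i > 0, removing the divergence leaves τ(ρ
-- log ρ), independently of σ.
theorem tendsto_logForm_sub (τ : FaithfulTrace M) {ρ σ : M} (hρ : IsStrictlyPositive ρ)
    (hσ : IsStrictlyPositive σ) :
    Tendsto (fun T => τ.logForm ρ σ T - (τ.toFun ρ).re * Real.log T) atTop
      (𝓝 (-τ.entropy ρ)) := by
  have hent : -τ.entropy ρ = ∑ i ∈ specFinset ρ, ∑ j ∈ specFinset σ,
      i * Real.log i * τ.specWeight ρ σ i j := by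
    have h : τ.entropy ρ = (τ.toFun (cfc Real.negMulLog ρ)).re := rfl
    rw [h, τ.trace_cfc_eq_sum hσ.isSelfAdjoint]
    simp [Real.negMulLog]
  have htr : (τ.toFun ρ).re = ∑ i ∈ specFinset ρ, ∑ j ∈ specFinset σ,
      i * τ.specWeight ρ σ i j := by
    have := τ.trace_cfc_eq_sum (ρ := ρ) hσ.isSelfAdjoint (fun t => t)
    rwa [cfc_id' ℝ ρ hρ.isSelfAdjoint] at this
  rw [hent]
  have key : Tendsto (fun T : ℝ => ∑ i ∈ specFinset ρ, ∑ j ∈ specFinset σ,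
      i * Real.log (j / T + i) * τ.specWeight ρ σ i j) atTop
      (𝓝 (∑ i ∈ specFinset ρ, ∑ j ∈ specFinset σ, i * Real.log i * τ.specWeight ρ σ i j)) := by
    refine tendsto_finsetSum _ fun i hi => tendsto_finsetSum _ fun j _ => ?_
    have hi := specFinset_pos hρ hi
    have h1 : Tendsto (fun T : ℝ => j / T + i) atTop (𝓝 i) := by
      simpa using (tendsto_const_nhds.div_atTop tendsto_id :
        Tendsto (fun T : ℝ => j / T) atTop _).add_const i
    exact ((h1.log hi.ne').const_mul i).mul_const _
  refine key.congr' ?_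
  filter_upwards [eventually_gt_atTop 0] with T hT
  unfold logForm
  rw [htr, Finset.sum_mul, ← Finset.sum_sub_distrib]
  refine Finset.sum_congr rfl fun i hi => ?_
  rw [Finset.sum_mul, ← Finset.sum_sub_distrib]
  refine Finset.sum_congr rfl fun j hj => ?_
  have hi := specFinset_pos hρ hi
  have hj := specFinset_pos hσ hj
  have : j / T + i = (j + T * i) / T := by field_simp
  rw [this, Real.log_div (by positivity) hT.ne']
  ring

/-- Monotonicity of relative entropy under trace-preserving conditional expectations. -/
theorem condExp_relEntropy_le [Nontrivial M] (τ : FaithfulTrace M)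
    (N : StarSubalgebra ℂ M) {ρ σ : M} (hρ : IsStrictlyPositive ρ) (hσ : IsStrictlyPositive σ) :
    -τ.entropy (τ.condExp N ρ) - (τ.toFun (τ.condExp N ρ * CFC.log (τ.condExp N σ))).re ≤
      -τ.entropy ρ - (τ.toFun (ρ * CFC.log σ)).re := by
  have hρ' := τ.condExp_isStrictlyPositive N hρ
  have hσ' := τ.condExp_isStrictlyPositive N hσ
  have hder : ∀ s : ℝ, 0 ≤ s → HasDerivAt
      (fun s => τ.logForm ρ σ s - τ.logForm (τ.condExp N ρ) (τ.condExp N σ) s) _ s :=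
    fun s hs => (τ.hasDerivAt_logForm hρ hσ hs).sub (τ.hasDerivAt_logForm hρ' hσ' hs)
  have hmono : MonotoneOn
      (fun s => τ.logForm ρ σ s - τ.logForm (τ.condExp N ρ) (τ.condExp N σ) s) (Set.Ici 0) := by
    refine monotoneOn_of_deriv_nonneg (convex_Ici 0)
      (fun s hs => (hder s hs).continuousAt.continuousWithinAt)
      (fun s hs => ?_) (fun s hs => ?_)
    · exact (hder s (interior_subset hs)).differentiableAt.differentiableWithinAt
    · rw [(hder s (interior_subset hs)).deriv]
      exact sub_nonneg.2 (τ.trace_mul_sylvester_condExp_le N hρ hσ (interior_subset hs))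
  have hlim := (τ.tendsto_logForm_sub hρ hσ).sub (τ.tendsto_logForm_sub hρ' hσ')
  have hle := ge_of_tendsto hlim
    (b := τ.logForm ρ σ 0 - τ.logForm (τ.condExp N ρ) (τ.condExp N σ) 0)
    (by
      filter_upwards [Filter.eventually_ge_atTop 0] with T hT
      have := hmono (Set.mem_Ici.2 le_rfl) hT hT
      -- Equal traces make the two log T counterterms cancel.
      rw [τ.trace_condExp]
      simp only at this
      linarith)
  rw [τ.logForm_zero hρ.isSelfAdjoint, τ.logForm_zero hρ'.isSelfAdjoint] at hle
  linarith

end FaithfulTrace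

theorem StarSubalgebra.log_mem_of_finiteDimensional {M : Type*} [CStarAlgebra M]
    [FiniteDimensional ℂ M] {N : StarSubalgebra ℂ M} {a : M} (ha : a ∈ N) : CFC.log a ∈ N :=
  N.cfc_mem_of_finiteDimensional ha _

/-! ### The overlap constant and the operator inequality it controls. -/

namespace FaithfulTrace

variable {M : Type*} [CStarAlgebra M] [PartialOrder M] [StarOrderedRing M]

theorem isStrictlyPositive_add_smul_one {ρ : M} (hρ : 0 ≤ ρ) {ε : ℝ} (hε : 0 < ε) :
    IsStrictlyPositive (ρ + ε • 1) :=
  .nonneg_add hρ (isStrictlyPositive_one.smul hε)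

theorem trace_eq_re (τ : FaithfulTrace M) {x : M} (hx : 0 ≤ x) :
    τ.toFun x = ((τ.toFun x).re : ℂ) :=
  Complex.ext rfl (by simpa using (Complex.nonneg_iff.1 (τ.trace_nonneg hx)).2.symm)

theorem trace_mul_eq_re (τ : FaithfulTrace M) {x y : M} (hx : 0 ≤ x) (hy : 0 ≤ y) :
    τ.toFun (x * y) = ((τ.toFun (x * y)).re : ℂ) :=
  Complex.ext rfl (by simpa using (Complex.nonneg_iff.1 (τ.trace_mul_nonneg hx hy)).2.symm)

theorem trace_one_re_pos [Nontrivial M] (τ : FaithfulTrace M) : 0 < (τ.toFun 1).re := by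
  refine lt_of_le_of_ne (τ.trace_re_nonneg zero_le_one) fun h => ?_
  exact one_ne_zero (τ.eq_zero_of_re_eq_zero zero_le_one h.symm)

variable [FiniteDimensional ℂ M]

/-- A faithful trace dominates a multiple of the norm on positive elements. -/
theorem exists_norm_le_mul_trace (τ : FaithfulTrace M) :
    ∃ C : ℝ, ∀ x : M, 0 ≤ x → ‖x‖ ≤ C * (τ.toFun x).re := by
  have : ProperSpace M := FiniteDimensional.proper ℂ M
  let f : M →ₗ[ℂ] ℂ :=
    { toFun := fun x => τ.toFun x, map_add' := map_add _, map_smul' := map_smul _ }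
  have hf : Continuous fun x : M => (τ.toFun x).re :=
    Complex.continuous_re.comp f.continuous_of_finiteDimensional
  have hK : IsCompact ({x : M | 0 ≤ x} ∩ Metric.sphere 0 1) :=
    (isCompact_sphere 0 1).inter_left CStarAlgebra.isClosed_nonneg
  rcases ({x : M | 0 ≤ x} ∩ Metric.sphere 0 1).eq_empty_or_nonempty with h | h
  · refine ⟨0, fun x hx => ?_⟩
    by_contra hne
    have hx0 : ‖x‖ ≠ 0 := fun h0 => hne (by simp [h0])
    have : ‖x‖⁻¹ • x ∈ ({x : M | 0 ≤ x} ∩ Metric.sphere 0 1) :=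
      ⟨smul_nonneg (by positivity) hx, by simp [norm_smul, hx0]⟩
    rw [h] at this
    exact this
  -- The trace attains a minimum on positive elements of norm one; faithfulness makes it positive,
  -- and its inverse serves as C.
  · obtain ⟨y, ⟨hy0, hy1⟩, hmin⟩ := hK.exists_isMinOn h hf.continuousOn
    have hy1 : ‖y‖ = 1 := by simpa using hy1
    have hypos : 0 < (τ.toFun y).re := by
      refine lt_of_le_of_ne (τ.trace_re_nonneg hy0) fun h0 => ?_
      rw [τ.eq_zero_of_re_eq_zero hy0 h0.symm, norm_zero] at hy1
      exact zero_ne_one hy1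
    refine ⟨((τ.toFun y).re)⁻¹, fun x hx => ?_⟩
    by_cases hx0 : ‖x‖ = 0
    · rw [hx0]
      exact mul_nonneg (inv_nonneg.2 hypos.le) (τ.trace_re_nonneg hx)
    · have hmem : ‖x‖⁻¹ • x ∈ ({x : M | 0 ≤ x} ∩ Metric.sphere 0 1) :=
        ⟨smul_nonneg (by positivity) hx, by simp [norm_smul, hx0]⟩
      have h1 : (τ.toFun y).re ≤ (τ.toFun (‖x‖⁻¹ • x)).re := hmin hmem
      rw [trace_real_smul, Complex.re_ofReal_mul] at h1
      have hx0' : 0 < ‖x‖ := lt_of_le_of_ne (norm_nonneg x) (Ne.symm hx0)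
      rw [← div_eq_inv_mul, le_div_iff₀ hx0'] at h1
      rw [← div_eq_inv_mul, le_div_iff₀ hypos]
      linarith

section overlap

variable (τ : FaithfulTrace M) (R A B : StarSubalgebra ℂ M)

theorem one_mem_overlapSet [Nontrivial M] : (1 : ℝ) ∈ τ.overlapSet R A B := by
  have h := τ.trace_one_re_pos
  have h1 := τ.trace_eq_re zero_le_one
  have h2 : τ.toFun (((τ.toFun 1).re⁻¹ : ℝ) • (1 : M)) = 1 := by
    rw [trace_real_smul]
    nth_rewrite 2 [h1]
    rw [← Complex.ofReal_mul, inv_mul_cancel₀ h.ne', Complex.ofReal_one]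
  refine ⟨1, one_mem A, ((τ.toFun 1).re⁻¹ : ℝ) • 1, ?_, zero_le_one, ?_, τ.condExp_one R, h2, ?_⟩
  · rw [← Complex.coe_smul]
    exact B.smul_mem (one_mem B) _
  · exact smul_nonneg (by positivity) zero_le_one
  · simpa using h2

/-- From a ≤ ‖a‖1 one gets τ(ab) ≤ ‖a‖, and ‖a‖ ≤ C τ(a) = C τ(1) because E_R preserves the trace.
-/
theorem bddAbove_overlapSet : BddAbove (τ.overlapSet R A B) := by
  obtain ⟨C, hC⟩ := τ.exists_norm_le_mul_trace
  refine ⟨C * (τ.toFun 1).re, ?_⟩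
  rintro t ⟨a, -, b, -, ha, hb, hER, htb, hab⟩
  have h1 : τ.toFun a = τ.toFun 1 := by rw [← τ.trace_condExp R a, hER]
  have h2 := hC a ha
  rw [h1] at h2
  have h3 : a ≤ ‖a‖ • 1 := by
    rw [← Algebra.algebraMap_eq_smul_one]
    exact IsSelfAdjoint.le_algebraMap_norm_self (.of_nonneg ha)
  have h4 := τ.trace_mul_re_mono hb h3
  have htb : τ.toFun b = 1 := htb
  have hab : τ.toFun (a * b) = t := hab
  rw [mul_smul_comm, mul_one, trace_real_smul, htb, τ.tracial, hab] at h4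
  simp at h4
  linarith

theorem isLUB_overlap [Nontrivial M] : IsLUB (τ.overlapSet R A B) (τ.overlap R A B) :=
  isLUB_csSup ⟨1, τ.one_mem_overlapSet R A B⟩ (τ.bddAbove_overlapSet R A B)

theorem one_le_overlap [Nontrivial M] : 1 ≤ τ.overlap R A B :=
  (τ.isLUB_overlap R A B).1 (τ.one_mem_overlapSet R A B)

variable {τ R A B}

theorem trace_mul_le_overlap_of_condExp_eq_one [Nontrivial M] {a b : M} (haA : a ∈ A) (hbB : b ∈ B)
    (ha : 0 ≤ a) (hb : 0 ≤ b) (hER : τ.condExp R a = 1) :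
    (τ.toFun (a * b)).re ≤ τ.overlap R A B * (τ.toFun b).re := by
  rcases (τ.trace_re_nonneg hb).eq_or_lt with h0 | h0
  · simp [τ.eq_zero_of_re_eq_zero hb h0.symm]
  · set t := (τ.toFun b).re with ht
    have h1 : τ.toFun ((t⁻¹ : ℝ) • b) = 1 := by
      rw [trace_real_smul, τ.trace_eq_re hb, ← ht, ← Complex.ofReal_mul, inv_mul_cancel₀ h0.ne',
        Complex.ofReal_one]
    have hb' : 0 ≤ (t⁻¹ : ℝ) • b := smul_nonneg (by positivity) hb
    have hmem : (τ.toFun (a * ((t⁻¹ : ℝ) • b))).re ∈ τ.overlapSet R A B := by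
      refine ⟨a, haA, (t⁻¹ : ℝ) • b, ?_, ha, hb', hER, h1, τ.trace_mul_eq_re ha hb'⟩
      rw [← Complex.coe_smul]
      exact B.smul_mem hbB _
    have h2 := (τ.isLUB_overlap R A B).1 hmem
    rw [mul_smul_comm, trace_real_smul, Complex.re_ofReal_mul, ← div_eq_inv_mul,
      div_le_iff₀ h0] at h2
    exact h2

/-- With r = E_R(a), replace a by r^(-1/2) a r^(-1/2), whose expectation is 1 by the bimodule
property, and b by r^(1/2) b r^(1/2). This leaves τ(ab) unchanged and turns τ(b) into τ(br). -/
theorem trace_mul_le_overlap [Nontrivial M] (hRA : R ≤ A) (hRB : R ≤ B) {a b : M} (haA : a ∈ A)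
    (hbB : b ∈ B) (ha : 0 ≤ a) (hb : 0 ≤ b) (hER : IsStrictlyPositive (τ.condExp R a)) :
    (τ.toFun (a * b)).re ≤ τ.overlap R A B * (τ.toFun (b * τ.condExp R a)).re := by
  set r := τ.condExp R a with hr
  have hrs := hER.isSelfAdjoint
  have hrR : r ∈ R := τ.condExp_mem R a
  have hc := continuousOn_spectrum_of_finiteDimensional r
  set u := cfc (fun t : ℝ => √t) r with hu
  set v := cfc (fun t : ℝ => (√t)⁻¹) r with hv
  have huR : u ∈ R := R.cfc_mem_of_finiteDimensional hrR _
  have hvR : v ∈ R := R.cfc_mem_of_finiteDimensional hrR _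
  have hus : IsSelfAdjoint u := .of_nonneg (cfc_nonneg fun t _ => Real.sqrt_nonneg t)
  have hvs : IsSelfAdjoint v := .of_nonneg (cfc_nonneg fun t _ => inv_nonneg.2 (Real.sqrt_nonneg t))
  have hsq : ∀ t ∈ spectrum ℝ r, √t ≠ 0 := fun t ht =>
    (Real.sqrt_pos.2 (hER.spectrum_pos ht)).ne'
  have huv : u * v = 1 := by
    rw [hu, hv, ← cfc_mul _ _ r (hc _) (hc _), ← cfc_const_one ℝ r]
    exact cfc_congr fun t ht => mul_inv_cancel₀ (hsq t ht)
  have hvu : v * u = 1 := by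
    rw [hu, hv, ← cfc_mul _ _ r (hc _) (hc _), ← cfc_const_one ℝ r]
    exact cfc_congr fun t ht => inv_mul_cancel₀ (hsq t ht)
  have huu : u * u = r := by
    rw [hu, ← cfc_mul _ _ r (hc _) (hc _)]
    conv_rhs => rw [← cfc_id' ℝ r]
    exact cfc_congr fun t ht => Real.mul_self_sqrt (hER.spectrum_pos ht).le
  have hvrv : v * r * v = 1 := by
    rw [← huu, ← mul_assoc v, hvu, one_mul, huv]
  have h := trace_mul_le_overlap_of_condExp_eq_one (τ := τ) (R := R) (A := A) (B := B)
    (a := v * a * v) (b := u * b * u)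
    (mul_mem (mul_mem (hRA hvR) haA) (hRA hvR)) (mul_mem (mul_mem (hRB huR) hbB) (hRB huR))
    (by simpa [hvs.star_eq] using star_left_conjugate_nonneg ha v)
    (by simpa [hus.star_eq] using star_left_conjugate_nonneg hb u)
    (by rw [τ.condExp_mul_mul R hvR hvR, ← hr, hvrv])
  have e1 : τ.toFun (v * a * v * (u * b * u)) = τ.toFun (a * b) := by
    have : v * a * v * (u * b * u) = v * (a * b * u) := by
      simp only [← mul_assoc]
      rw [mul_assoc (v * a) v u, hvu, mul_one]
    rw [this, τ.tracial, mul_assoc, huv, mul_one]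
  have e2 : τ.toFun (u * b * u) = τ.toFun (b * r) := by
    rw [mul_assoc, τ.tracial, mul_assoc, huu]
  rwa [e1, e2] at h

/-- Both sides lie in B, so positive b in B suffice as tests. Apply the overlap bound to a = E_A ρ,
using E_R E_A = E_R. -/
theorem condExp_condExp_le [Nontrivial M] (hRA : R ≤ A) (hRB : R ≤ B) {ρ : M}
    (hρ : IsStrictlyPositive ρ) :
    τ.condExp B (τ.condExp A ρ) ≤ τ.overlap R A B • τ.condExp R ρ := by
  have hA := τ.condExp_isStrictlyPositive A hρ
  have hBA := τ.condExp_isStrictlyPositive B hA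
  have hR := τ.condExp_isStrictlyPositive R hρ
  have hRA' : τ.condExp R (τ.condExp A ρ) = τ.condExp R ρ :=
    (τ.condExp_eq_of R (τ.condExp_mem R ρ) fun z hz => by
      rw [τ.toFun_mul_condExp R ρ hz, τ.toFun_mul_condExp A ρ (hRA hz)])
  rw [← sub_nonneg]
  refine τ.nonneg_of_trace_mul_re_nonneg (N := B) ?_ ?_ fun b hb hb0 => ?_
  · refine sub_mem ?_ (τ.condExp_mem B _)
    rw [← Complex.coe_smul]
    exact B.smul_mem (hRB (τ.condExp_mem R ρ)) _
  · exact (IsSelfAdjoint.smul (by simp [isSelfAdjoint_iff]) hR.isSelfAdjoint).sub hBA.isSelfAdjoint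
  · have h := trace_mul_le_overlap (τ := τ) (R := R) hRA hRB (τ.condExp_mem A ρ) hb hA.nonneg hb0
      (by rw [hRA']; exact hR)
    rw [hRA'] at h
    rw [mul_sub, map_sub, τ.toFun_mul_condExp B _ hb, mul_smul_comm, trace_real_smul, τ.tracial b
      (τ.condExp A ρ), Complex.sub_re, Complex.re_ofReal_mul]
    linarith

end overlap

/-! ### The entropy inequality for invertible ρ. -/

section entropy

variable (τ : FaithfulTrace M)

theorem entropy_eq_neg_trace_mul_log {ρ : M} (hρ : IsSelfAdjoint ρ) :
    τ.entropy ρ = -(τ.toFun (ρ * CFC.log ρ)).re := by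
  have hc := continuousOn_spectrum_of_finiteDimensional ρ
  have h : ρ * CFC.log ρ = -cfc Real.negMulLog ρ := by
    rw [← cfc_neg, CFC.log]
    nth_rewrite 1 [← cfc_id' ℝ ρ]
    rw [← cfc_mul _ _ ρ (hc _) (hc _)]
    congr 1
    funext t
    simp [Real.negMulLog]
  rw [h, map_neg, Complex.neg_re, neg_neg]
  rfl

/-- Holds because log(E_N ρ) lies in N; it makes D(ρ‖E_N ρ) a difference of entropies. -/
theorem trace_mul_log_condExp (N : StarSubalgebra ℂ M) {ρ : M} (hρ : 0 ≤ ρ) :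
    (τ.toFun (ρ * CFC.log (τ.condExp N ρ))).re = -τ.entropy (τ.condExp N ρ) := by
  rw [τ.entropy_eq_neg_trace_mul_log (.of_nonneg (τ.condExp_nonneg N hρ)), neg_neg, τ.tracial,
    ← τ.toFun_mul_condExp N ρ (StarSubalgebra.log_mem_of_finiteDimensional (τ.condExp_mem N ρ)),
    τ.tracial]

variable {τ} {R A B : StarSubalgebra ℂ M}

/-- The factor τ(ρ) is kept since the perturbations ρ + ε1 used later are not normalised. -/
theorem entropy_add_le_of_isStrictlyPositive [Nontrivial M] (hRA : R ≤ A) (hRB : R ≤ B) {ρ : M}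
    (hρ : IsStrictlyPositive ρ) :
    τ.entropy ρ + τ.entropy (τ.condExp R ρ) - (τ.toFun ρ).re * Real.log (τ.overlap R A B) ≤
      τ.entropy (τ.condExp A ρ) + τ.entropy (τ.condExp B ρ) := by
  have hA := τ.condExp_isStrictlyPositive A hρ
  have hB := τ.condExp_isStrictlyPositive B hρ
  have hBA := τ.condExp_isStrictlyPositive B hA
  have hR := τ.condExp_isStrictlyPositive R hρ
  have hc : 0 < τ.overlap R A B := zero_lt_one.trans_le (τ.one_le_overlap R A B)
  have h1 := τ.condExp_relEntropy_le B hρ hA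
  rw [τ.trace_mul_log_condExp A hρ.nonneg] at h1
  have h2 := τ.trace_mul_re_mono hB.nonneg
    (CFC.log_le_log (condExp_condExp_le (τ := τ) hRA hRB hρ) hBA)
  rw [CFC.log_smul _ (fun t ht => (hR.spectrum_pos ht).ne') hc.ne' hR.isSelfAdjoint,
    mul_add, map_add, Algebra.algebraMap_eq_smul_one, mul_smul_comm, mul_one, trace_real_smul,
    τ.trace_condExp, τ.tracial _ (CFC.log (τ.condExp R ρ)),
    τ.toFun_mul_condExp B ρ (StarSubalgebra.log_mem_of_finiteDimensional (hRB (τ.condExp_mem R ρ))),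
    τ.tracial _ ρ, Complex.add_re, Complex.re_ofReal_mul] at h2
  have h3 := τ.trace_mul_log_condExp R hρ.nonneg
  linarith

end entropy

end FaithfulTrace

/-! ### Removal of invertibility, and the commuting square criterion. -/

namespace FaithfulTrace

variable {M : Type*} [CStarAlgebra M] [PartialOrder M] [StarOrderedRing M]
  [FiniteDimensional ℂ M]

open Filter Topology in
theorem tendsto_entropy_add_smul_one (τ : FaithfulTrace M) {y : M} (hy : IsSelfAdjoint y) :
    Tendsto (fun ε : ℝ => τ.entropy (y + ε • 1)) (𝓝[>] 0) (𝓝 (τ.entropy y)) := by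
  have hc := continuousOn_spectrum_of_finiteDimensional y
  have h : ∀ ε : ℝ, τ.entropy (y + ε • 1) =
      ∑ t ∈ specFinset y, Real.negMulLog (t + ε) * (τ.toFun (specProj y t)).re := by
    intro ε
    have h1 : y + ε • 1 = cfc (fun t : ℝ => t + ε) y := by
      rw [cfc_add_const ε (fun t => t) y, cfc_id' ℝ y, Algebra.algebraMap_eq_smul_one]
    have h2 : cfc Real.negMulLog (y + ε • 1) = cfc (fun t => Real.negMulLog (t + ε)) y := by
      rw [h1, ← cfc_comp' Real.negMulLog (fun t : ℝ => t + ε) y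
        Real.continuous_negMulLog.continuousOn (hc _)]
    have h3 : τ.entropy (y + ε • 1) = (τ.toFun (cfc Real.negMulLog (y + ε • 1))).re := rfl
    rw [h3, h2, cfc_eq_sum_specProj, map_sum, Complex.re_sum]
    exact Finset.sum_congr rfl fun t _ => by rw [trace_real_smul, Complex.re_ofReal_mul]
  have h0 := h 0
  rw [zero_smul, add_zero] at h0
  rw [h0]
  simp only [h]
  refine tendsto_nhdsWithin_of_tendsto_nhds (Continuous.tendsto ?_ 0)
  exact continuous_finsetSum _ fun t _ =>
    (Real.continuous_negMulLog.comp (continuous_const.add continuous_id)).mul continuous_const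

theorem condExp_add_smul_one (τ : FaithfulTrace M) (N : StarSubalgebra ℂ M) (ρ : M) (ε : ℝ) :
    τ.condExp N (ρ + ε • 1) = τ.condExp N ρ + ε • 1 := by
  rw [map_add, ← Complex.coe_smul, map_smul, condExp_one]

variable {τ : FaithfulTrace M} {R A B : StarSubalgebra ℂ M}

theorem entropy_add_le_of_isDensity [Nontrivial M] (hRA : R ≤ A) (hRB : R ≤ B) {ρ : M}
    (hρ : τ.IsDensity ρ) :
    τ.entropy ρ + τ.entropy (τ.condExp R ρ) + Real.log (1 / τ.overlap R A B) ≤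
      τ.entropy (τ.condExp A ρ) + τ.entropy (τ.condExp B ρ) := by
  obtain ⟨hρ0, hρ1⟩ := hρ
  have hρ1 : τ.toFun ρ = 1 := hρ1
  have hlim : ∀ N : StarSubalgebra ℂ M, Filter.Tendsto
      (fun ε : ℝ => τ.entropy (τ.condExp N (ρ + ε • 1))) (nhdsWithin 0 (Set.Ioi 0))
      (nhds (τ.entropy (τ.condExp N ρ))) := by
    intro N
    simp only [condExp_add_smul_one]
    exact τ.tendsto_entropy_add_smul_one (.of_nonneg (τ.condExp_nonneg N hρ0))
  have htr : Filter.Tendsto (fun ε : ℝ => (τ.toFun (ρ + ε • 1)).re * Real.log (τ.overlap R A B))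
      (nhdsWithin 0 (Set.Ioi 0)) (nhds (1 * Real.log (τ.overlap R A B))) := by
    have h : ∀ ε : ℝ, (τ.toFun (ρ + ε • 1)).re = 1 + ε * (τ.toFun 1).re := fun ε => by
      rw [map_add, hρ1, trace_real_smul, Complex.add_re, Complex.re_ofReal_mul, Complex.one_re]
    simp only [h]
    refine tendsto_nhdsWithin_of_tendsto_nhds (Filter.Tendsto.mul_const _ ?_)
    have : Continuous fun ε : ℝ => 1 + ε * (τ.toFun 1).re := by fun_prop
    simpa using this.tendsto 0
  have h := le_of_tendsto_of_tendsto
    (((τ.tendsto_entropy_add_smul_one (.of_nonneg hρ0)).add (hlim R)).sub htr)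
    ((hlim A).add (hlim B))
    (by
      filter_upwards [self_mem_nhdsWithin] with ε hε
      exact entropy_add_le_of_isStrictlyPositive hRA hRB (isStrictlyPositive_add_smul_one hρ0 hε))
  rw [one_div, Real.log_inv]
  linarith

/-- Every admissible pair gives exactly τ(ab) = τ(a E_A b) = τ(a E_R b) = τ(E_R(a) b) = 1. -/
theorem overlap_eq_one_of_condExp_comp (hAB : τ.condExp A ∘ₗ τ.condExp B = τ.condExp R)
    [Nontrivial M] : τ.overlap R A B = 1 := by
  refine (τ.isLUB_overlap R A B).unique ⟨?_, fun t ht => ht (τ.one_mem_overlapSet R A B)⟩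
  rintro t ⟨a, haA, b, hbB, -, -, hER, htb, hab⟩
  have htb : τ.toFun b = 1 := htb
  have hab : τ.toFun (a * b) = t := hab
  have h1 : τ.condExp A b = τ.condExp R b := by
    have := LinearMap.congr_fun hAB b
    rwa [LinearMap.comp_apply, τ.condExp_of_mem B hbB] at this
  have h2 : τ.toFun (a * b) = 1 := by
    rw [← τ.toFun_mul_condExp A b haA, h1, ← τ.trace_condExp_mul R, hER, one_mul, htb]
  rw [hab] at h2
  exact le_of_eq (by exact_mod_cast h2)

theorem condExp_comp_eq_of_overlap_eq_one [Nontrivial M] (hRA : R ≤ A) (hRB : R ≤ B)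
    (h : τ.overlap R A B = 1) : τ.condExp B ∘ₗ τ.condExp A = τ.condExp R := by
  have hpos : ∀ ρ : M, IsStrictlyPositive ρ → τ.condExp B (τ.condExp A ρ) = τ.condExp R ρ := by
    intro ρ hρ
    have h1 := condExp_condExp_le (τ := τ) hRA hRB hρ
    rw [h, one_smul, ← sub_nonneg] at h1
    have h2 := τ.faithful _ h1 (by simp only [map_sub, trace_condExp, sub_self])
    exact (sub_eq_zero.1 h2).symm
  have hnn : ∀ ρ : M, 0 ≤ ρ → τ.condExp B (τ.condExp A ρ) = τ.condExp R ρ := by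
    intro ρ hρ
    have h1 := hpos _ (isStrictlyPositive_add_smul_one hρ zero_lt_one)
    simpa only [condExp_add_smul_one, add_left_inj] using h1
  -- Positive elements span M.
  refine LinearMap.ext_on (s := {x : M | 0 ≤ x}) CStarAlgebra.span_nonneg fun ρ hρ => hnn ρ hρ

/-- Each expectation is symmetric for the nondegenerate pairing τ(xy), so transposing reverses the
composition. -/
theorem condExp_comp_comm (h : τ.condExp B ∘ₗ τ.condExp A = τ.condExp R) :
    τ.condExp A ∘ₗ τ.condExp B = τ.condExp R := by
  ext y
  refine τ.eq_of_trace_mul_eq (N := ⊤) trivial trivial fun x _ => ?_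
  rw [LinearMap.comp_apply, ← trace_condExp_mul, ← trace_condExp_mul, ← trace_condExp_mul, ← h,
    LinearMap.comp_apply]

end FaithfulTrace

/-- `M` is a nonzero finite-dimensional C*-algebra, i.e. (up to isomorphism) a finite-dimensional
von Neumann algebra; `StarSubalgebra`s contain the unit of `M`. -/
theorem corollary3p3 {M : Type*} [CStarAlgebra M] [PartialOrder M] [StarOrderedRing M]
    [FiniteDimensional ℂ M] [Nontrivial M] (τ : FaithfulTrace M)
    (R A B : StarSubalgebra ℂ M) (hRA : R ≤ A) (hRB : R ≤ B) :
    IsLUB (τ.overlapSet R A B) (τ.overlap R A B) ∧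
    (∀ ρ : M, τ.IsDensity ρ →
      τ.entropy ρ + τ.entropy (τ.condExp R ρ) + Real.log (1 / τ.overlap R A B) ≤
        τ.entropy (τ.condExp A ρ) + τ.entropy (τ.condExp B ρ)) ∧
    (τ.overlap R A B = 1 ↔
      τ.condExp A ∘ₗ τ.condExp B = τ.condExp R ∧ τ.condExp B ∘ₗ τ.condExp A = τ.condExp R) := by
  refine ⟨τ.isLUB_overlap R A B, fun ρ hρ => FaithfulTrace.entropy_add_le_of_isDensity hRA hRB hρ,
    fun h => ?_, fun h => FaithfulTrace.overlap_eq_one_of_condExp_comp h.1⟩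
  have hBA := FaithfulTrace.condExp_comp_eq_of_overlap_eq_one hRA hRB h
  exact ⟨FaithfulTrace.condExp_comp_comm hBA, hBA⟩
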